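/- Let $$G=\sum_{n=0}^\infty\frac{(-1)^n}{(2n+1)^2}$$ be Catalan's constant, and for real sequences $(a_n)_{n\ge 0}$, $(b_n)_{n\ge 1}$ write $$\mathrm{CF}[a_n,b_n]=a_0+\cfrac{b_1}{a_1+\cfrac{b_2}{a_2+\ddots}}$$ for the limit, as $N\to\infty$, of the finite continued fractions $a_0+\cfrac{b_1}{a_1+\cfrac{b_2}{\ddots+\cfrac{b_N}{a_N}}}$. Then $$\frac{1}{2G}=\mathrm{CF}\left[3n^2+3n+1,\,-2n^4\right];$$ that is, with $a_n=3n^2+3n+1$ and $b_n=-2n^4$, no division by zero occurs in any of these finite continued fractions, and they converge to $\frac{1}{2G}$. -/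

import Mathlib

open Filter Topology

/-- Catalan's constant `G = 1 - 1/3² + 1/5² - 1/7² + ⋯`. The series converges absolutely, so the
sum is not a default value. -/
noncomputable def catalanConstant : ℝ :=
  ∑' n : ℕ, (-1 : ℝ) ^ n / (2 * (n : ℝ) + 1) ^ 2

/-- The infinite continued fraction `CF[a_n, b_n] = a₀ + b₁ / (a₁ + b₂ / (a₂ + ⋯))`: the head term
is `a₀`, and for `n = 1, 2, …` the partial numerator is `b_n` and the partial denominator is `a_n`.
The value `b 0` is not used. (In the library, the components `a` and `b` of a
`GenContFract.Pair` are the partial numerator and the partial denominator, in this order.) -/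
def contFrac (a b : ℕ → ℝ) : GenContFract ℝ where
  h := a 0
  s := Stream'.Seq.ofStream fun n : ℕ => ⟨b (n + 1), a (n + 1)⟩

/-- `CF[a_n, b_n] = x`: all truncations `a₀ + b₁ / (a₁ + b₂ / (⋯ + b_N / a_N))` of the continued
fraction are meaningful, and they converge to `x` as `N → ∞`.

`(contFrac a b).convs' N` is that truncation, evaluated as a nested fraction. By the first conjunct
no division by zero occurs in it: the denominators in it are the nested
fractions `a_k + b_{k+1} / (a_{k+1} + ⋯ + b_{k+n} / a_{k+n})` with `1 ≤ k` and `k + n = N`. -/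
def HasCFValue (a b : ℕ → ℝ) (x : ℝ) : Prop :=
  (∀ k n : ℕ, 1 ≤ k →
    (contFrac (fun i => a (k + i)) (fun i => b (k + i))).convs' n ≠ 0) ∧
  Tendsto (fun N : ℕ => (contFrac a b).convs' N) atTop (𝓝 x)

/-! Divided by n!², the numerators A_n and denominators B_n of the convergents (index shifted by
one) solve a recurrence with limiting characteristic roots 1 and 2. A bounded solution is I_n = ∫₀¹
(1 - s)^n K(s) ds, handled only as the series `minimalSolution`. As I_0 = 2G
(`tsum_wallisWeight_div`) and I_1 = 2G - 1, it equals 2G·A_n - B_n. Since A_n → ∞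
(`IsCatalanRecurrence.growth`), B_n / A_n → 2G. A lower bound for the tails
(`le_contFrac_tail_catalan`) excludes zero denominators. -/

/-! ### Wallis weights: the coefficients of K -/

open Real.Wallis in
/-- The weight `π / 2 * (centralBinom k / 4 ^ k) ^ 2`, written with the Wallis product. -/
noncomputable def wallisWeight (k : ℕ) : ℝ :=
  Real.pi / 2 / (W k * (2 * k + 1))

lemma wallisWeight_pos (k : ℕ) : 0 < wallisWeight k := by
  have := Real.Wallis.W_pos k
  have := Real.pi_pos
  unfold wallisWeight
  positivity

lemma wallisWeight_succ (k : ℕ) :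
    wallisWeight (k + 1) = wallisWeight k * ((2 * k + 1) ^ 2 / (2 * k + 2) ^ 2) := by
  have hW := (Real.Wallis.W_pos k).ne'
  have h2 : (2 * (k : ℝ) + 3) ≠ 0 := by positivity
  unfold wallisWeight
  rw [Real.Wallis.W_succ]
  push_cast
  have h3 : (2 * ((k : ℝ) + 1) + 1) ≠ 0 := by positivity
  field_simp
  ring

lemma wallisWeight_le (k : ℕ) : wallisWeight k ≤ 2 / (2 * k + 1) := by
  have hW := Real.Wallis.W_pos k
  have h := Real.Wallis.le_W k
  have h1 : (0 : ℝ) < 2 * k + 1 := by positivity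
  have h2 : Real.pi / 2 ≤ 2 * Real.Wallis.W k := by
    have h3 : (1 : ℝ) / 2 ≤ (2 * k + 1) / (2 * k + 2) := by
      rw [div_le_div_iff₀ (by norm_num) (by positivity)]
      have : (0 : ℝ) ≤ k := by positivity
      linarith
    have := mul_le_mul_of_nonneg_right h3 (by positivity : 0 ≤ Real.pi / 2)
    linarith
  unfold wallisWeight
  rw [div_le_div_iff₀ (by positivity) h1]
  nlinarith

lemma tendsto_mul_wallisWeight :
    Tendsto (fun k : ℕ => (2 * (k : ℝ) + 1) * wallisWeight k) atTop (𝓝 1) := by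
  have hp : Real.pi / 2 ≠ 0 := by positivity
  have h := (tendsto_const_nhds (x := Real.pi / 2)).div
    Real.Wallis.tendsto_W_nhds_pi_div_two hp
  rw [div_self hp] at h
  refine h.congr fun k => ?_
  have hW := (Real.Wallis.W_pos k).ne'
  simp only [wallisWeight, Pi.div_apply]
  field_simp

/-! ### The series for 2G -/

/-- `∏ i < j, (k - i) / (k + i + 1)`, that is `k! ^ 2 / ((k - j)! * (k + j)!)`. -/
noncomputable def centralRatio (j k : ℕ) : ℝ :=
  ∏ i ∈ Finset.range j, ((k : ℝ) - i) / (k + i + 1)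

lemma centralRatio_succ (j k : ℕ) :
    centralRatio (j + 1) k = centralRatio j k * (((k : ℝ) - j) / (k + j + 1)) :=
  Finset.prod_range_succ _ _

lemma centralRatio_eq_zero {j k : ℕ} (h : k < j) : centralRatio j k = 0 :=
  Finset.prod_eq_zero (Finset.mem_range.2 h) (by simp)

lemma centralRatio_nonneg (j k : ℕ) : 0 ≤ centralRatio j k := by
  rcases lt_or_ge k j with h | h
  · rw [centralRatio_eq_zero h]
  · refine Finset.prod_nonneg fun i hi => div_nonneg ?_ (by positivity)
    have : (i : ℝ) ≤ k := by exact_mod_cast (Finset.mem_range.1 hi).le.trans h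
    linarith

lemma centralRatio_le_one (j k : ℕ) : centralRatio j k ≤ 1 := by
  rcases lt_or_ge k j with h | h
  · rw [centralRatio_eq_zero h]; exact zero_le_one
  · refine Finset.prod_le_one (fun i hi => div_nonneg ?_ (by positivity)) fun i hi => ?_
    · have : (i : ℝ) ≤ k := by exact_mod_cast (Finset.mem_range.1 hi).le.trans h
      linarith
    · rw [div_le_one (by positivity)]
      have : (0 : ℝ) ≤ i := by positivity
      linarith

lemma centralRatio_succ_right (j k : ℕ) :
    centralRatio j (k + 1) * ((k + 1 - j) * (k + j + 1)) = (k + 1) ^ 2 * centralRatio j k := by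
  induction j with
  | zero => simp [centralRatio]; ring
  | succ j ih =>
    rw [centralRatio_succ, centralRatio_succ]
    push_cast
    have h1 : ((k : ℝ) + j + 1) ≠ 0 := by positivity
    have h2 : ((k : ℝ) + 1 + j + 1) ≠ 0 := by positivity
    field_simp
    linear_combination (k - j : ℝ) * (k + 1 + j + 1) * ih

lemma tendsto_add_div_add (a b : ℝ) :
    Tendsto (fun k : ℕ => ((k : ℝ) + a) / (k + b)) atTop (𝓝 1) := by
  have h1 : Tendsto (fun k : ℕ => (k : ℝ) + b) atTop atTop :=
    tendsto_atTop_add_const_right _ _ tendsto_natCast_atTop_atTop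
  have h2 := (tendsto_const_nhds (x := (1 : ℝ))).add (h1.const_div_atTop (a - b))
  rw [add_zero] at h2
  refine h2.congr' ?_
  filter_upwards [h1.eventually_gt_atTop 0] with k hk
  field_simp
  ring

lemma tendsto_centralRatio (j : ℕ) :
    Tendsto (fun k => centralRatio j k) atTop (𝓝 1) := by
  have h := tendsto_finsetProd (Finset.range j)
    (fun i _ => tendsto_add_div_add (-(i : ℝ)) (i + 1))
  rw [Finset.prod_const_one] at h
  refine h.congr fun k => Finset.prod_congr rfl fun i _ => ?_
  rw [sub_eq_add_neg, add_assoc]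

lemma hasSum_of_sub_of_tendsto {f F : ℕ → ℝ} {l : ℝ} (hf : ∀ k, 0 ≤ f k)
    (h : ∀ k, f k = F (k + 1) - F k) (h0 : F 0 = 0) (hF : Tendsto F atTop (𝓝 l)) :
    HasSum f l := by
  rw [hasSum_iff_tendsto_nat_of_nonneg hf]
  refine hF.congr fun n => ?_
  rw [Finset.sum_congr rfl fun k _ => h k, Finset.sum_range_sub, h0, sub_zero]

lemma hasSum_wallisWeight_mul_centralRatio (j : ℕ) :
    HasSum (fun k : ℕ => wallisWeight k * (centralRatio j k / (k + j + 1)))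
      (2 / (2 * (j : ℝ) + 1) ^ 2) := by
  refine hasSum_of_sub_of_tendsto
    -- An antidifference in k of the summand. It vanishes at 0 (through `k - j` if j = 0, through
    -- `centralRatio` otherwise), and its limit is the sum because `wallisWeight k * (k - j)` tends
    -- to 1/2.
    (F := fun k : ℕ => 4 / (2 * (j : ℝ) + 1) ^ 2 * (wallisWeight k * (k - j) * centralRatio j k))
    (fun k => ?_) (fun k => ?_) ?_ ?_
  · have := wallisWeight_pos k
    have := centralRatio_nonneg j k
    positivity
  · have h1 : ((k : ℝ) + j + 1) ≠ 0 := by positivity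
    have h3 : centralRatio j (k + 1) * (k + 1 - j) =
        (k + 1) ^ 2 * centralRatio j k / (k + j + 1) := by
      rw [eq_div_iff h1, ← centralRatio_succ_right]; ring
    have h4 : wallisWeight (k + 1) * (((k + 1 : ℕ) : ℝ) - j) * centralRatio j (k + 1) =
        wallisWeight (k + 1) * ((k + 1) ^ 2 * centralRatio j k / (k + j + 1)) := by
      rw [← h3]; push_cast; ring
    rw [h4, wallisWeight_succ]
    field_simp
    ring
  · cases j with
    | zero => simp
    | succ j => simp [centralRatio_eq_zero]
  · have h := ((tendsto_mul_wallisWeight.mul (tendsto_add_div_add (-(j : ℝ)) (1 / 2))).mul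
      (tendsto_centralRatio j)).const_mul (2 / (2 * (j : ℝ) + 1) ^ 2)
    simp only [mul_one] at h
    refine h.congr fun k => ?_
    have : (k : ℝ) + 1 / 2 ≠ 0 := by positivity
    field_simp
    ring

lemma summable_two_div_sq : Summable fun k : ℕ => (2 : ℝ) / (2 * k + 1) ^ 2 := by
  have h := ((Real.summable_one_div_nat_pow.2 one_lt_two).comp_injective
    (i := fun k : ℕ => 2 * k + 1) (fun a b h => by simpa using h)).mul_left (2 : ℝ)
  refine h.congr fun k => ?_
  simp [div_eq_mul_inv]

lemma wallisWeight_div_le (k : ℕ) :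
    wallisWeight k / (2 * k + 1) ≤ 2 / (2 * (k : ℝ) + 1) ^ 2 := by
  have h := div_le_div_of_nonneg_right (wallisWeight_le k)
    (by positivity : (0 : ℝ) ≤ 2 * k + 1)
  rwa [div_div, ← sq] at h

lemma summable_wallisWeight_div : Summable fun k : ℕ => wallisWeight k / (2 * k + 1) :=
  Summable.of_nonneg_of_le (fun k => div_nonneg (wallisWeight_pos k).le (by positivity))
    wallisWeight_div_le summable_two_div_sq

/-- An expansion of 1 / (2k + 1) with exact remainder, which vanishes once n > k. -/
lemma sum_centralRatio (n k : ℕ) :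
    ∑ j ∈ Finset.range n, (-1 : ℝ) ^ j * (centralRatio j k / (k + j + 1)) =
      (1 - (-1) ^ n * centralRatio n k) / (2 * k + 1) := by
  induction n with
  | zero => simp [centralRatio]
  | succ n ih =>
    rw [Finset.sum_range_succ, ih, centralRatio_succ, pow_succ]
    have h1 : ((k : ℝ) + n + 1) ≠ 0 := by positivity
    field_simp
    ring

lemma tendsto_tsum_centralRatio :
    Tendsto (fun n : ℕ => ∑' k : ℕ, wallisWeight k / (2 * k + 1) * ((-1) ^ n * centralRatio n k))
      atTop (𝓝 0) := by
  have h := tendsto_tsum_of_dominated_convergence (𝓕 := atTop)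
    (f := fun (n k : ℕ) => wallisWeight k / (2 * k + 1) * ((-1) ^ n * centralRatio n k))
    (g := fun _ => (0 : ℝ)) summable_wallisWeight_div (fun k => ?_) ?_
  · simpa using h
  · refine tendsto_const_nhds.congr' ?_
    filter_upwards [eventually_gt_atTop k] with n hn
    rw [centralRatio_eq_zero hn]; simp
  · refine Eventually.of_forall fun n k => ?_
    have h0 : 0 ≤ wallisWeight k / (2 * k + 1) :=
      div_nonneg (wallisWeight_pos k).le (by positivity)
    rw [norm_mul, norm_mul, norm_pow, norm_neg, norm_one, one_pow, one_mul,
      Real.norm_of_nonneg h0, Real.norm_of_nonneg (centralRatio_nonneg n k)]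
    exact mul_le_of_le_one_right h0 (centralRatio_le_one n k)

lemma summable_catalan : Summable fun n : ℕ => (-1 : ℝ) ^ n / (2 * (n : ℝ) + 1) ^ 2 := by
  refine Summable.of_norm_bounded summable_two_div_sq fun n => ?_
  rw [norm_div, norm_pow, norm_neg, norm_one, one_pow, Real.norm_of_nonneg (by positivity)]
  gcongr
  norm_num

/-- Expand 1 / (2k + 1) by `sum_centralRatio` and sum over k first: the j-th term becomes 2(-1)^j /
(2j + 1)². Stopping at j < n keeps the interchange finite; the remainder tends to 0 by dominated
convergence. -/
lemma tsum_wallisWeight_div :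
    ∑' k : ℕ, wallisWeight k / (2 * k + 1) = 2 * catalanConstant := by
  have h1 := (summable_catalan.hasSum.tendsto_sum_nat).const_mul 2
  have h2 := (tendsto_const_nhds (x := ∑' k : ℕ, wallisWeight k / (2 * k + 1))).sub
    tendsto_tsum_centralRatio
  rw [sub_zero] at h2
  refine tendsto_nhds_unique (h2.congr fun n => ?_) h1
  have hs : Summable fun k : ℕ =>
      wallisWeight k / (2 * k + 1) * ((-1) ^ n * centralRatio n k) := by
    refine Summable.of_norm_bounded summable_wallisWeight_div fun k => ?_
    have h0 : 0 ≤ wallisWeight k / (2 * k + 1) :=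
      div_nonneg (wallisWeight_pos k).le (by positivity)
    rw [norm_mul, norm_mul, norm_pow, norm_neg, norm_one, one_pow, one_mul,
      Real.norm_of_nonneg h0, Real.norm_of_nonneg (centralRatio_nonneg n k)]
    exact mul_le_of_le_one_right h0 (centralRatio_le_one n k)
  rw [← summable_wallisWeight_div.tsum_sub hs]
  have h3 := hasSum_sum (s := Finset.range n) fun j _ =>
    (hasSum_wallisWeight_mul_centralRatio j).mul_left ((-1 : ℝ) ^ j)
  rw [Finset.mul_sum]
  convert h3.tsum_eq using 1
  · refine tsum_congr fun k => ?_
    have := sum_centralRatio n k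
    calc _ = wallisWeight k * ((1 - (-1) ^ n * centralRatio n k) / (2 * k + 1)) := by ring
      _ = _ := by
        rw [← this, Finset.mul_sum]
        exact Finset.sum_congr rfl fun j _ => by ring
  · exact Finset.sum_congr rfl fun j _ => by ring

/-! ### Moments of K and their recurrence -/

/-- The beta integral `∫ s in 0..1, s ^ (2 * k) * (1 - s) ^ n`. -/
noncomputable def betaMoment (k n : ℕ) : ℝ :=
  ((2 * k).factorial * n.factorial : ℝ) / (2 * k + n + 1).factorial

lemma betaMoment_pos (k n : ℕ) : 0 < betaMoment k n := by
  unfold betaMoment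
  positivity

lemma betaMoment_zero (k : ℕ) : betaMoment k 0 = 1 / (2 * k + 1) := by
  unfold betaMoment
  rw [add_zero, Nat.factorial_succ (2 * k)]
  have := Nat.factorial_ne_zero (2 * k)
  push_cast
  field_simp
  simp

lemma betaMoment_succ (k n : ℕ) :
    betaMoment k (n + 1) = betaMoment k n * ((n + 1) / (2 * k + n + 2)) := by
  unfold betaMoment
  rw [← add_assoc, Nat.factorial_succ (2 * k + n + 1), Nat.factorial_succ n]
  have := Nat.factorial_ne_zero (2 * k + n + 1)
  push_cast
  field_simp
  ring

lemma betaMoment_succ_left (k n : ℕ) :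
    betaMoment (k + 1) n =
      betaMoment k n * ((2 * k + 1) * (2 * k + 2) / ((2 * k + n + 2) * (2 * k + n + 3))) := by
  unfold betaMoment
  rw [show 2 * (k + 1) + n + 1 = 2 * k + n + 1 + 1 + 1 by ring, show 2 * (k + 1) = 2 * k + 1 + 1 by
    ring, Nat.factorial_succ (2 * k + n + 1 + 1), Nat.factorial_succ (2 * k + n + 1),
    Nat.factorial_succ (2 * k + 1), Nat.factorial_succ (2 * k)]
  have := Nat.factorial_ne_zero (2 * k + n + 1)
  push_cast
  have h1 : (2 * (k : ℝ) + n + 2) ≠ 0 := by positivity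
  have h2 : (2 * (k : ℝ) + n + 3) ≠ 0 := by positivity
  have h3 : (2 * (k : ℝ) + n + 1 + 1) ≠ 0 := by positivity
  have h4 : (2 * (k : ℝ) + n + 1 + 1 + 1) ≠ 0 := by positivity
  field_simp
  ring

lemma betaMoment_antitone (k : ℕ) : Antitone (betaMoment k) := by
  refine antitone_nat_of_succ_le fun n => ?_
  rw [betaMoment_succ]
  refine mul_le_of_le_one_right (betaMoment_pos k n).le ?_
  rw [div_le_one (by positivity)]
  have : (0 : ℝ) ≤ k := by positivity
  linarith

lemma wallisWeight_mul_betaMoment_le (k n : ℕ) :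
    wallisWeight k * betaMoment k n ≤ wallisWeight k / (2 * k + 1) := by
  have h := betaMoment_antitone k (Nat.zero_le n)
  rw [betaMoment_zero] at h
  have := mul_le_mul_of_nonneg_left h (wallisWeight_pos k).le
  rwa [mul_one_div] at this

lemma summable_wallisWeight_mul_betaMoment (n : ℕ) :
    Summable fun k => wallisWeight k * betaMoment k n :=
  Summable.of_nonneg_of_le
    (fun k => (mul_pos (wallisWeight_pos k) (betaMoment_pos k n)).le)
    (fun k => wallisWeight_mul_betaMoment_le k n) summable_wallisWeight_div

/-- The minimal solution `∫ s in 0..1, (1 - s) ^ n * K s` of the recurrence, with `K` the complete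
elliptic integral of the first kind, expanded in powers of `s`. -/
noncomputable def minimalSolution (n : ℕ) : ℝ :=
  ∑' k, wallisWeight k * betaMoment k n

lemma minimalSolution_zero : minimalSolution 0 = 2 * catalanConstant := by
  rw [← tsum_wallisWeight_div]
  refine tsum_congr fun k => ?_
  rw [betaMoment_zero, mul_one_div]

lemma minimalSolution_nonneg (n : ℕ) : 0 ≤ minimalSolution n :=
  tsum_nonneg fun k => (mul_pos (wallisWeight_pos k) (betaMoment_pos k n)).le

lemma minimalSolution_le (n : ℕ) : minimalSolution n ≤ 2 * catalanConstant := by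
  rw [← tsum_wallisWeight_div]
  exact (summable_wallisWeight_mul_betaMoment n).tsum_le_tsum
    (fun k => wallisWeight_mul_betaMoment_le k n) summable_wallisWeight_div

lemma catalanConstant_pos : 0 < catalanConstant := by
  have h : 0 < minimalSolution 0 := (summable_wallisWeight_mul_betaMoment 0).tsum_pos
    (fun k => (mul_pos (wallisWeight_pos k) (betaMoment_pos k 0)).le) 0
    (mul_pos (wallisWeight_pos 0) (betaMoment_pos 0 0))
  rw [minimalSolution_zero] at h
  linarith

/-- I_0 - I_1 = ∑ w_k / (2k + 2), with w_k the Wallis weights, is half the telescoping sum for j =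
0. -/
lemma minimalSolution_one : minimalSolution 1 = 2 * catalanConstant - 1 := by
  have h := (hasSum_wallisWeight_mul_centralRatio 0).mul_left (1 / 2)
  have h0 := (summable_wallisWeight_mul_betaMoment 0).hasSum
  have h2 := (h0.sub h).tsum_eq
  change _ = minimalSolution 0 - _ at h2
  rw [minimalSolution_zero] at h2
  norm_num at h2
  rw [← h2]
  refine tsum_congr fun k => ?_
  rw [betaMoment_succ, betaMoment_zero]
  simp only [centralRatio, Finset.range_zero, Finset.prod_empty]
  push_cast
  field_simp
  ring

/-- The recurrence satisfied by numerators and denominators of the continued fraction, after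
division by the squares of the factorials. -/
def IsCatalanRecurrence (y : ℕ → ℝ) : Prop :=
  ∀ n : ℕ, ((n : ℝ) + 2) ^ 2 * y (n + 2) =
    (3 * ((n : ℝ) + 1) ^ 2 + 3 * (n + 1) + 1) * y (n + 1) - 2 * ((n : ℝ) + 1) ^ 2 * y n

/-- Creative telescoping: applied to the k-th summand, the recurrence operator gives F (k + 1) - F
k, where F 0 = 0 and F k = O(1/k). -/
lemma isCatalanRecurrence_minimalSolution : IsCatalanRecurrence minimalSolution := by
  intro n
  have hs (m : ℕ) := (summable_wallisWeight_mul_betaMoment m).hasSum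
  have h1 := ((hs (n + 1)).mul_left (3 * ((n : ℝ) + 1) ^ 2 + 3 * (n + 1) + 1)).sub
    ((hs n).mul_left (2 * ((n : ℝ) + 1) ^ 2))
  have h2 := ((hs (n + 2)).mul_left (((n : ℝ) + 2) ^ 2)).sub h1
  let F : ℕ → ℝ := fun k =>
    -(2 * k * (2 * k + (n + 1 : ℕ) + 1) * (wallisWeight k * betaMoment k (n + 1)))
  have hF : Tendsto F atTop (𝓝 0) := by
    have hb : Tendsto (fun k : ℕ => ((n : ℝ) + 2) * 2 / (k + 1)) atTop (𝓝 0) :=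
      (tendsto_atTop_add_const_right _ _ tendsto_natCast_atTop_atTop).const_div_atTop _
    refine squeeze_zero_norm (fun k => ?_) hb
    have hw := wallisWeight_pos k
    have hm := betaMoment_pos k (n + 1)
    rw [norm_neg, Real.norm_of_nonneg (by positivity)]
    have hm1 : betaMoment k (n + 1) ≤ 1 / ((2 * k + 1) * (2 * k + 2)) := by
      refine (betaMoment_antitone k (Nat.le_add_left 1 n)).trans_eq ?_
      rw [betaMoment_succ, betaMoment_zero]
      push_cast
      field_simp
      ring
    calc 2 * k * (2 * k + (n + 1 : ℕ) + 1) * (wallisWeight k * betaMoment k (n + 1))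
        ≤ (2 * k + 1) * ((n + 2) * (2 * k + 1)) *
          (2 / (2 * k + 1) * (1 / ((2 * k + 1) * (2 * k + 2)))) := by
          gcongr
          · linarith
          · push_cast
            have : (0 : ℝ) ≤ n * k := by positivity
            have : (0 : ℝ) ≤ k := by positivity
            nlinarith
          · exact wallisWeight_le k
      _ = (n + 2) / (k + 1) := by field_simp
      _ ≤ _ := by gcongr; linarith
  have h3 := h2.tendsto_sum_nat
  have h4 := tendsto_nhds_unique h3 (hF.congr fun N => ?_)
  · change _ * minimalSolution (n + 2) - (_ * minimalSolution (n + 1) - _ * minimalSolution n) = 0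
      at h4
    linarith
  · rw [← sub_zero (F N), show (0 : ℝ) = F 0 by simp [F], ← Finset.sum_range_sub]
    refine Finset.sum_congr rfl fun k _ => ?_
    simp only [F]
    rw [wallisWeight_succ, betaMoment_succ_left, betaMoment_succ k (n + 1), betaMoment_succ k n]
    push_cast
    have e1 : (2 * (k : ℝ) + n + 2) ≠ 0 := by positivity
    have e2 : (2 * (k : ℝ) + (n + 1) + 2) ≠ 0 := by positivity
    have e3 : (2 * (k : ℝ) + (n + 1) + 3) ≠ 0 := by positivity
    field_simp
    ring

/-! ### Normalised numerators and denominators -/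

/-- The solution of the recurrence with given initial values. -/
noncomputable def catalanRecSolution (x y : ℝ) : ℕ → ℝ
  | 0 => x
  | 1 => y
  | n + 2 => ((3 * ((n : ℝ) + 1) ^ 2 + 3 * (n + 1) + 1) * catalanRecSolution x y (n + 1) -
      2 * ((n : ℝ) + 1) ^ 2 * catalanRecSolution x y n) / ((n : ℝ) + 2) ^ 2

lemma isCatalanRecurrence_catalanRecSolution (x y : ℝ) :
    IsCatalanRecurrence (catalanRecSolution x y) := by
  intro n
  rw [catalanRecSolution]
  field_simp

lemma IsCatalanRecurrence.ext {y z : ℕ → ℝ} (hy : IsCatalanRecurrence y)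
    (hz : IsCatalanRecurrence z) (h0 : y 0 = z 0) (h1 : y 1 = z 1) (n : ℕ) : y n = z n := by
  induction n using Nat.twoStepInduction with
  | zero => exact h0
  | one => exact h1
  | more n ih0 ih1 =>
    have h := hy n
    rw [ih0, ih1, ← hz n] at h
    exact mul_left_cancel₀ (by positivity) h

lemma IsCatalanRecurrence.linear_comb {y z : ℕ → ℝ} (hy : IsCatalanRecurrence y)
    (hz : IsCatalanRecurrence z) (c : ℝ) : IsCatalanRecurrence fun n => c * y n - z n := by
  intro n
  linear_combination c * hy n - hz n

lemma minimalSolution_eq (n : ℕ) :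
    minimalSolution n =
      2 * catalanConstant * catalanRecSolution 1 1 n - catalanRecSolution 0 1 n := by
  refine isCatalanRecurrence_minimalSolution.ext
    ((isCatalanRecurrence_catalanRecSolution 1 1).linear_comb
      (isCatalanRecurrence_catalanRecSolution 0 1) (2 * catalanConstant)) ?_ ?_ n
  · simp [minimalSolution_zero, catalanRecSolution]
  · simp [minimalSolution_one, catalanRecSolution]

/-- The identity `key` expresses each difference positively through the previous one and y. The
first difference is (2(1 - y 0) + 1) / 4 ≥ 1/4, and this bound propagates; any slope up to 1/4 would
do in place of 1/8. -/
lemma IsCatalanRecurrence.growth {y : ℕ → ℝ} (hy : IsCatalanRecurrence y) (h1 : y 1 = 1)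
    (h0 : y 0 ≤ 1) (n : ℕ) :
    1 + (n : ℝ) / 8 ≤ y (n + 1) ∧ 1 / 4 ≤ y (n + 2) - y (n + 1) := by
  have key (n : ℕ) : ((n : ℝ) + 2) ^ 2 * (y (n + 2) - y (n + 1)) =
      2 * ((n : ℝ) + 1) ^ 2 * (y (n + 1) - y n) + (n + 1) * y (n + 1) := by
    linear_combination hy n
  induction n with
  | zero =>
    have := key 0
    norm_num [h1] at this ⊢
    linarith
  | succ n ih =>
    obtain ⟨ih1, ih2⟩ := ih
    have hn : (0 : ℝ) ≤ n := by positivity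
    have h3 : 1 + ((n + 1 : ℕ) : ℝ) / 8 ≤ y (n + 2) := by push_cast; linarith
    refine ⟨h3, ?_⟩
    have h4 := key (n + 1)
    push_cast at h3 h4
    rw [show n + 1 + 2 = n + 3 by rfl, show n + 1 + 1 = n + 2 by rfl] at *
    have h5 : 2 * ((n : ℝ) + 1 + 1) ^ 2 * (1 / 4) ≤
        2 * ((n : ℝ) + 1 + 1) ^ 2 * (y (n + 2) - y (n + 1)) := by gcongr
    have h6 : ((n : ℝ) + 1 + 1) * 1 ≤ (n + 1 + 1) * y (n + 2) := by
      gcongr; linarith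
    by_contra! h7
    have h8 : ((n : ℝ) + 1 + 2) ^ 2 * (y (n + 3) - y (n + 2)) < (n + 1 + 2) ^ 2 * (1 / 4) := by
      gcongr
    nlinarith

lemma tendsto_catalanRecSolution_div :
    Tendsto (fun n => catalanRecSolution 1 1 (n + 1) / catalanRecSolution 0 1 (n + 1)) atTop
      (𝓝 (1 / (2 * catalanConstant))) := by
  have hA := (isCatalanRecurrence_catalanRecSolution 1 1).growth rfl le_rfl
  have hApos (n : ℕ) : 0 < catalanRecSolution 1 1 (n + 1) := by
    have := (hA n).1
    have : (0 : ℝ) ≤ n := by positivity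
    linarith
  have hAtop : Tendsto (fun n => catalanRecSolution 1 1 (n + 1)) atTop atTop := by
    refine tendsto_atTop_mono (fun n => (hA n).1) ?_
    exact tendsto_atTop_add_const_left _ _
      (tendsto_natCast_atTop_atTop.atTop_div_const (by norm_num))
  have hr : Tendsto (fun n => minimalSolution (n + 1) / catalanRecSolution 1 1 (n + 1)) atTop
      (𝓝 0) := by
    refine squeeze_zero (fun n => div_nonneg (minimalSolution_nonneg _) (hApos n).le)
      (fun n => ?_) (hAtop.const_div_atTop (2 * catalanConstant))
    exact div_le_div_of_nonneg_right (minimalSolution_le _) (hApos n).le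
  have h := ((tendsto_const_nhds (x := 2 * catalanConstant)).sub hr).inv₀
    (by have := catalanConstant_pos; linarith)
  rw [sub_zero, ← one_div] at h
  refine h.congr fun n => ?_
  have hne := (hApos n).ne'
  rw [minimalSolution_eq, ← inv_div]
  field_simp
  ring

/-! ### Nested fractions and their tails -/

lemma contFrac_convs'_zero (a b : ℕ → ℝ) : (contFrac a b).convs' 0 = a 0 := by
  simp [GenContFract.convs', GenContFract.convs'Aux, contFrac]

lemma contFrac_convs'_succ (a b : ℕ → ℝ) (n : ℕ) :
    (contFrac a b).convs' (n + 1) =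
      a 0 + b 1 / (contFrac (fun i => a (1 + i)) (fun i => b (1 + i))).convs' n := by
  simp only [GenContFract.convs', GenContFract.convs'Aux, contFrac, add_comm 1]
  rfl

lemma contFrac_tail_convs'_succ (a b : ℕ → ℝ) (k n : ℕ) :
    (contFrac (fun i => a (k + i)) (fun i => b (k + i))).convs' (n + 1) =
      a k + b (k + 1) /
        (contFrac (fun i => a (k + 1 + i)) (fun i => b (k + 1 + i))).convs' n := by
  rw [contFrac_convs'_succ]
  simp only [add_zero, add_assoc]

/-- A solution of the three-term recurrence is determined, up to a common nonzero factor, by the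
truncated tails of the continued fraction. -/
lemma exists_factor_contFrac_tail {a b : ℕ → ℝ}
    (h : ∀ k n : ℕ, 1 ≤ k →
      (contFrac (fun i => a (k + i)) (fun i => b (k + i))).convs' n ≠ 0) (n k : ℕ) :
    ∃ Q : ℝ, Q ≠ 0 ∧ ∀ Y : ℕ → ℝ,
      (∀ j, Y (j + 2) = a (j + 1) * Y (j + 1) + b (j + 1) * Y j) →
      Y (k + n + 2) = Q *
        ((contFrac (fun i => a (k + 1 + i)) (fun i => b (k + 1 + i))).convs' n * Y (k + 1) +
          b (k + 1) * Y k) := by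
  induction n generalizing k with
  | zero =>
    refine ⟨1, one_ne_zero, fun Y hY => ?_⟩
    rw [contFrac_convs'_zero, one_mul]
    exact hY k
  | succ n ih =>
    obtain ⟨Q, hQ, hQY⟩ := ih (k + 1)
    have hT := h (k + 1 + 1) n (by omega)
    -- The new factor is the next tail, which clears the denominator.
    refine ⟨Q * _, mul_ne_zero hQ hT, fun Y hY => ?_⟩
    rw [contFrac_tail_convs'_succ, show k + (n + 1) + 2 = k + 1 + n + 2 by ring, hQY Y hY, hY k]
    field_simp
    ring

/-- If the next tail is at least 2(k + 1)², this one is at least 3k² + 3k + 1 - (k + 1)² = 2k² + k.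
-/
lemma le_contFrac_tail_catalan (n : ℕ) : ∀ k : ℕ, 1 ≤ k → 2 * (k : ℝ) ^ 2 ≤
    (contFrac (fun i => 3 * ((k + i : ℕ) : ℝ) ^ 2 + 3 * ((k + i : ℕ) : ℝ) + 1)
      (fun i => -2 * ((k + i : ℕ) : ℝ) ^ 4)).convs' n := by
  induction n with
  | zero =>
    intro k _
    rw [contFrac_convs'_zero, add_zero]
    have : (0 : ℝ) ≤ k := by positivity
    nlinarith
  | succ n ih =>
    intro k hk
    rw [contFrac_tail_convs'_succ (fun i => 3 * (i : ℝ) ^ 2 + 3 * (i : ℝ) + 1)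
      (fun i => -2 * (i : ℝ) ^ 4)]
    have h := ih (k + 1) (by omega)
    set T := (contFrac (fun i => 3 * ((k + 1 + i : ℕ) : ℝ) ^ 2 + 3 * ((k + 1 + i : ℕ) : ℝ) + 1)
      (fun i => -2 * ((k + 1 + i : ℕ) : ℝ) ^ 4)).convs' n
    push_cast at h ⊢
    have hT : 0 < T := lt_of_lt_of_le (by positivity) h
    have h2 : 2 * ((k : ℝ) + 1) ^ 4 / T ≤ (k + 1) ^ 2 := by
      rw [div_le_iff₀ hT]
      nlinarith [mul_le_mul_of_nonneg_left h (by positivity : (0 : ℝ) ≤ (k + 1) ^ 2)]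
    rw [neg_mul, neg_div]
    have : (0 : ℝ) ≤ k := by positivity
    nlinarith

lemma IsCatalanRecurrence.factorial_sq_mul {y : ℕ → ℝ} (hy : IsCatalanRecurrence y) (j : ℕ) :
    ((j + 2).factorial : ℝ) ^ 2 * y (j + 2) =
      (3 * ((j + 1 : ℕ) : ℝ) ^ 2 + 3 * ((j + 1 : ℕ) : ℝ) + 1) *
          (((j + 1).factorial : ℝ) ^ 2 * y (j + 1)) +
        -2 * ((j + 1 : ℕ) : ℝ) ^ 4 * ((j.factorial : ℝ) ^ 2 * y j) := by
  rw [Nat.factorial_succ (j + 1), Nat.factorial_succ j]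
  push_cast
  linear_combination ((j : ℝ) + 1) ^ 2 * (j.factorial : ℝ) ^ 2 * hy j

theorem corollary2p1 :
    HasCFValue (fun n : ℕ => 3 * (n : ℝ) ^ 2 + 3 * (n : ℝ) + 1) (fun n : ℕ => -2 * (n : ℝ) ^ 4)
      (1 / (2 * catalanConstant)) := by
  have htail : ∀ k n : ℕ, 1 ≤ k →
      (contFrac (fun i => (fun n : ℕ => 3 * (n : ℝ) ^ 2 + 3 * (n : ℝ) + 1) (k + i))
        (fun i => (fun n : ℕ => -2 * (n : ℝ) ^ 4) (k + i))).convs' n ≠ 0 := fun k n hk =>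
    (lt_of_lt_of_le (by positivity) (le_contFrac_tail_catalan n k hk)).ne'
  refine ⟨htail, (tendsto_add_atTop_iff_nat 1).1 ?_⟩
  refine ((tendsto_add_atTop_iff_nat 1).2 tendsto_catalanRecSolution_div).congr fun n => ?_
  obtain ⟨Q, hQ, h⟩ := exists_factor_contFrac_tail
    (a := fun n : ℕ => 3 * (n : ℝ) ^ 2 + 3 * (n : ℝ) + 1) (b := fun n : ℕ => -2 * (n : ℝ) ^ 4)
    htail n 0
  have hA := h (fun j => (j.factorial : ℝ) ^ 2 * catalanRecSolution 1 1 j)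
    (isCatalanRecurrence_catalanRecSolution 1 1).factorial_sq_mul
  have hB := h (fun j => (j.factorial : ℝ) ^ 2 * catalanRecSolution 0 1 j)
    (isCatalanRecurrence_catalanRecSolution 0 1).factorial_sq_mul
  have hT := htail (0 + 1) n le_rfl
  rw [contFrac_convs'_succ]
  simp only [zero_add] at hA hB hT ⊢
  set T := (contFrac (fun i => 3 * ((1 + i : ℕ) : ℝ) ^ 2 + 3 * ((1 + i : ℕ) : ℝ) + 1)
      (fun i => -2 * ((1 + i : ℕ) : ℝ) ^ 4)).convs' n
  have hf : ((n + 2).factorial : ℝ) ^ 2 ≠ 0 := by positivity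
  rw [← mul_div_mul_left _ _ hf, hA, hB, mul_div_mul_left _ _ hQ]
  -- The initial values (1, 1) and (0, 1) leave (T - 2) / T = a₀ + b₁ / T.
  simp [catalanRecSolution]
  field_simp
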